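/- For a finite simple graph $G$ with vertex set $\{1,\dots,n\}$, the symmetric edge polytope of $G$ is $P_G=\operatorname{conv}\{\pm(e_i-e_j) : \{i,j\}\in E(G)\}\subset\mathbb{R}^n$, where $e_1,\dots,e_n$ is the standard basis of $\mathbb{R}^n$; let $N(G)$ denote the number of facets of $P_G$, that is, of faces of $P_G$ of dimension $\dim P_G-1$. For odd $n\ge 3$, let $WM(n)$ be the full windmill graph on $n$ vertices, i.e. the graph consisting of $\frac{n-1}{2}$ triangles that all share one common vertex and are otherwise disjoint. Then for every odd $n\ge 3$, $$N(WM(n)) = 6^{\frac{n-1}{2}}.$$ -/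

import Mathlib

/-- The symmetric edge polytope of a graph `G` on a finite vertex set `V`: the convex hull in `ℝ^V` of
all vectors `± (e_i - e_j)` with `{i, j}` an edge. Adjacency is symmetric, so letting `(i, j)` run
over all ordered adjacent pairs produces both signs. -/
def symmetricEdgePolytope {V : Type*} [DecidableEq V] (G : SimpleGraph V) : Set (V → ℝ) :=
  convexHull ℝ {x | ∃ i j : V, G.Adj i j ∧ x = Pi.single i 1 - Pi.single j 1}

open Classical in
/-- The dimension of a set in a real vector space: the dimension of its affine span, with the
convention that the empty set has dimension `-1`. -/
noncomputable def affineDimension {E : Type*} [AddCommGroup E] [Module ℝ E] (S : Set E) : ℤ :=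
  if S = ∅ then -1 else (Module.finrank ℝ (vectorSpan ℝ S) : ℤ)

/-- A facet of a polytope `P` is a face of dimension `dim P - 1`. A face is either empty or the set
of all points of `P` at which some linear functional attains its maximum over `P`; this is what
`IsExposed` says. -/
def IsFacet {E : Type*} [AddCommGroup E] [Module ℝ E] [TopologicalSpace E] (P F : Set E) : Prop :=
  IsExposed ℝ P F ∧ affineDimension F = affineDimension P - 1

/-- The number of facets of a polytope. -/
noncomputable def numFacets {E : Type*} [AddCommGroup E] [Module ℝ E] [TopologicalSpace E]
    (P : Set E) : ℕ :=
  {F : Set E | IsFacet P F}.ncard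

/-- The windmill graph `WM(n, r)` (for `2 * r ≤ n - 1`) on the vertices `0, …, n - 1`: `r` triangles
`{0, 2t - 1, 2t}` for `t = 1, …, r` and `n - 1 - 2 * r` further edges `{0, i}`, all wedged at the
vertex `0`. -/
def windmill (n r : ℕ) : SimpleGraph (Fin n) where
  Adj i j := i ≠ j ∧
    (i.val = 0 ∨ j.val = 0 ∨ ((i.val + 1) / 2 = (j.val + 1) / 2 ∧ (i.val + 1) / 2 ≤ r))
  symm := ⟨fun i j h => by
    obtain ⟨h, h'⟩ := h
    refine ⟨h.symm, ?_⟩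
    omega⟩
  loopless := ⟨fun _ h => h.1 rfl⟩

/-- The full windmill `WM(n)` (for odd `n`): the wedge of `(n - 1) / 2` triangles at one vertex. -/
def fullWindmill (n : ℕ) : SimpleGraph (Fin n) :=
  windmill n ((n - 1) / 2)

/-! A functional on `ℝ^V` is a vertex labelling `u`, and its value on `e_i - e_j` is `u i - u j`.
Since the polytope is centrally symmetric, each facet lies at height 1 of a labelling that changes
by at most 1 along edges and whose tight edges (change exactly 1) give vectors spanning the span of
all edge vectors (`isFacet_symmetricEdgePolytope_iff`).

In a windmill these conditions split over the triangles. Normalise the hub to 0: spanning means that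
the tight edges connect each triangle, so at least two of its three edges are tight. All three
cannot be, since three signs `±1` around a cycle do not sum to 0. Choosing the slack edge and the
global sign gives six labellings per triangle (`exists_triangleLabels_eq`). The choices are
independent, and distinct choices give distinct facets (`windmillFace_injective`). -/

open Set

/-! ### Facets of centrally symmetric convex hulls -/

section SymmetricConvexHull

variable {E : Type*} [AddCommGroup E] [Module ℝ E]

/-- A maximal face of a convex hull lies in the span of the generators that it contains. -/
theorem mem_span_of_mem_convexHull_of_apply_eq {A : Set E} (l : E →ₗ[ℝ] ℝ) {c : ℝ}
    (hl : ∀ a ∈ A, l a ≤ c) {x : E} (hx : x ∈ convexHull ℝ A) (hxc : l x = c) :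
    x ∈ Submodule.span ℝ {a | a ∈ A ∧ l a = c} := by
  have hconv : Convex ℝ {x | l x ≤ c ∧ (l x = c → x ∈ Submodule.span ℝ {a | a ∈ A ∧ l a = c})} := by
    rintro x ⟨hx, hx'⟩ y ⟨hy, hy'⟩ s t hs ht hst
    have hle : s * l x + t * l y ≤ c := by
      have : c = s * c + t * c := by rw [← add_mul, hst, one_mul]
      nlinarith [mul_le_mul_of_nonneg_left hx hs, mul_le_mul_of_nonneg_left hy ht]
    refine ⟨by simpa using hle, fun h => ?_⟩
    have h : s * l x + t * l y = c := by simpa using h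
    have hc : c = s * c + t * c := by rw [← add_mul, hst, one_mul]
    have h1 := mul_le_mul_of_nonneg_left hx hs
    have h2 := mul_le_mul_of_nonneg_left hy ht
    refine Submodule.add_mem _ ?_ ?_
    -- A convex combination at the maximum has every point of positive weight at the maximum; a
    -- point of weight zero contributes nothing.
    · rcases hs.eq_or_lt with rfl | hs
      · simp
      · exact Submodule.smul_mem _ _ (hx' (mul_left_cancel₀ hs.ne' (by linarith)))
    · rcases ht.eq_or_lt with rfl | ht
      · simp
      · exact Submodule.smul_mem _ _ (hy' (mul_left_cancel₀ ht.ne' (by linarith)))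
  refine (convexHull_min ?_ hconv hx).2 hxc
  exact fun a ha => ⟨hl a ha, fun h => Submodule.subset_span ⟨ha, h⟩⟩

theorem apply_le_of_mem_convexHull {A : Set E} (l : E →ₗ[ℝ] ℝ) {c : ℝ}
    (hl : ∀ a ∈ A, l a ≤ c) {x : E} (hx : x ∈ convexHull ℝ A) : l x ≤ c :=
  convexHull_min (t := {x | l x ≤ c}) hl (convex_halfSpace_le l.isLinear c) hx

theorem span_face_convexHull {A : Set E} (l : E →ₗ[ℝ] ℝ) {c : ℝ} (hl : ∀ a ∈ A, l a ≤ c) :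
    Submodule.span ℝ {x | x ∈ convexHull ℝ A ∧ l x = c} =
      Submodule.span ℝ {a | a ∈ A ∧ l a = c} := by
  refine le_antisymm (Submodule.span_le.2 fun x hx => ?_) (Submodule.span_mono fun a ha => ?_)
  · exact mem_span_of_mem_convexHull_of_apply_eq l hl hx.1 hx.2
  · exact ⟨subset_convexHull ℝ A ha.1, ha.2⟩

/-- Each `a` is half the difference of the points `a` and `-a`. -/
theorem vectorSpan_convexHull_of_neg_mem {A : Set E} (hA : ∀ a ∈ A, -a ∈ A) :
    vectorSpan ℝ (convexHull ℝ A) = Submodule.span ℝ A := by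
  rw [← direction_affineSpan, affineSpan_convexHull, direction_affineSpan]
  refine le_antisymm (Submodule.span_le.2 ?_) (Submodule.span_le.2 fun a ha => ?_)
  · rintro _ ⟨a, ha, b, hb, rfl⟩
    exact Submodule.sub_mem _ (Submodule.subset_span ha) (Submodule.subset_span hb)
  · have h : (2⁻¹ : ℝ) • (a -ᵥ -a) ∈ vectorSpan ℝ A :=
      Submodule.smul_mem _ _ (vsub_mem_vectorSpan ℝ ha (hA a ha))
    have h2 : (2⁻¹ : ℝ) • (a -ᵥ -a) = a := by
      rw [vsub_eq_sub, sub_neg_eq_add, ← two_smul ℝ a, smul_smul]; norm_num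
    rwa [h2] at h

/-- The linear span of a nonempty set in an affine hyperplane that misses the origin has one
dimension more than its affine span. -/
theorem finrank_span_eq_finrank_vectorSpan_add_one [FiniteDimensional ℝ E] {F : Set E}
    (hF : F.Nonempty) (l : E →ₗ[ℝ] ℝ) (hl : ∀ x ∈ F, l x = 1) :
    Module.finrank ℝ (Submodule.span ℝ F) = Module.finrank ℝ (vectorSpan ℝ F) + 1 := by
  obtain ⟨a, ha⟩ := hF
  have hker : vectorSpan ℝ F ≤ LinearMap.ker l := by
    refine Submodule.span_le.2 ?_
    rintro _ ⟨x, hx, y, hy, rfl⟩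
    simp [hl x hx, hl y hy]
  have hsup : Submodule.span ℝ F = vectorSpan ℝ F ⊔ Submodule.span ℝ {a} := by
    refine le_antisymm (Submodule.span_le.2 fun x hx => ?_) (sup_le (Submodule.span_le.2 ?_) ?_)
    · have : x = (x -ᵥ a) + a := by simp
      rw [this]
      exact Submodule.add_mem_sup (vsub_mem_vectorSpan ℝ hx ha) (Submodule.mem_span_singleton_self a)
    · rintro _ ⟨x, hx, y, hy, rfl⟩
      exact Submodule.sub_mem _ (Submodule.subset_span hx) (Submodule.subset_span hy)
    · exact Submodule.span_mono (by simpa using ha)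
  have hinf : vectorSpan ℝ F ⊓ Submodule.span ℝ {a} = ⊥ := by
    rw [eq_bot_iff]
    rintro x ⟨hx, hx'⟩
    obtain ⟨r, rfl⟩ := Submodule.mem_span_singleton.1 hx'
    have : l (r • a) = 0 := hker hx
    rw [map_smul, hl a ha, smul_eq_mul, mul_one] at this
    simp [this]
  have ha0 : a ≠ 0 := by
    rintro rfl
    simpa using hl 0 ha
  have h := Submodule.finrank_sup_add_finrank_inf_eq (vectorSpan ℝ F) (Submodule.span ℝ {a})
  rw [hinf, ← hsup, finrank_bot, finrank_span_singleton ha0] at h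
  exact h

theorem affineDimension_of_nonempty {S : Set E} (hS : S.Nonempty) :
    affineDimension S = (Module.finrank ℝ (vectorSpan ℝ S) : ℤ) :=
  if_neg hS.ne_empty

/-- The facets of the convex hull of a centrally symmetric set `A` are cut out by the linear
functionals that are at most `1` on `A` and for which the points of `A` at height `1` span. -/
theorem isFacet_convexHull_iff [TopologicalSpace E] [IsTopologicalAddGroup E]
    [ContinuousSMul ℝ E] [FiniteDimensional ℝ E] {A : Set E} (hA : ∀ a ∈ A, -a ∈ A)
    (hne : Submodule.span ℝ A ≠ ⊥) (F : Set E) :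
    IsFacet (convexHull ℝ A) F ↔ ∃ l : E →L[ℝ] ℝ, (∀ a ∈ A, l a ≤ 1) ∧
      F = {x | x ∈ convexHull ℝ A ∧ l x = 1} ∧
      Submodule.span ℝ {a | a ∈ A ∧ l a = 1} = Submodule.span ℝ A := by
  have hAne : A.Nonempty := by
    rw [nonempty_iff_ne_empty]
    rintro rfl
    exact hne Submodule.span_empty
  have hdim : affineDimension (convexHull ℝ A) = (Module.finrank ℝ (Submodule.span ℝ A) : ℤ) := by
    rw [affineDimension_of_nonempty hAne.convexHull, vectorSpan_convexHull_of_neg_mem hA]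
  have hpos : 0 < Module.finrank ℝ (Submodule.span ℝ A) := by
    rw [Nat.pos_iff_ne_zero, Ne, Submodule.finrank_eq_zero]
    exact hne
  constructor
  · rintro ⟨hexp, hF⟩
    rw [hdim] at hF
    -- The empty face has dimension `-1`, so it could be a facet only of a polytope of dimension 0.
    have hFne : F.Nonempty := by
      rw [nonempty_iff_ne_empty]
      rintro rfl
      rw [affineDimension, if_pos rfl] at hF
      omega
    obtain ⟨l, hl⟩ := hexp hFne
    obtain ⟨x₀, hx₀⟩ := hFne
    have hx₀' : x₀ ∈ convexHull ℝ A ∧ ∀ y ∈ convexHull ℝ A, l y ≤ l x₀ := by rwa [hl] at hx₀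
    have hle : ∀ a ∈ A, l a ≤ l x₀ := fun a ha => hx₀'.2 a (subset_convexHull ℝ A ha)
    have hFl : F = {x | x ∈ convexHull ℝ A ∧ l x = l x₀} := by
      rw [hl]
      ext x
      refine ⟨fun h => ⟨h.1, le_antisymm (hx₀'.2 x h.1) (h.2 x₀ hx₀'.1)⟩, fun h => ⟨h.1, ?_⟩⟩
      intro y hy
      rw [h.2]
      exact hx₀'.2 y hy
    -- A maximum `≤ 0` makes `l` vanish on the symmetric set `A`, so `F` would be the whole
    -- polytope. Positivity allows rescaling the maximum to 1.
    have hM : 0 < l x₀ := by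
      by_contra! hM
      have h0 : ∀ a ∈ A, l a = 0 := fun a ha => by
        have h1 := hle a ha
        have h2 := hle (-a) (hA a ha)
        rw [map_neg] at h2
        linarith
      have hP : ∀ x ∈ convexHull ℝ A, l x = 0 := fun x hx =>
        convexHull_min (t := (LinearMap.ker (l : E →ₗ[ℝ] ℝ) : Set E)) h0
          (Submodule.convex _) hx
      have : F = convexHull ℝ A := by
        rw [hFl]
        ext x
        exact ⟨fun h => h.1, fun h => ⟨h, by rw [hP x h, hP x₀ hx₀'.1]⟩⟩
      rw [this, hdim] at hF
      omega
    have hiff : ∀ x, ((l x₀)⁻¹ • l) x = 1 ↔ l x = l x₀ := fun x => by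
      simp only [smul_apply, smul_eq_mul]
      rw [inv_mul_eq_one₀ hM.ne', eq_comm]
    have hle1 : ∀ a ∈ A, ((l x₀)⁻¹ • l) a ≤ 1 := fun a ha => by
      simp only [smul_apply, smul_eq_mul]
      rw [inv_mul_le_one₀ hM]
      exact hle a ha
    have hF1 : F = {x | x ∈ convexHull ℝ A ∧ ((l x₀)⁻¹ • l) x = 1} := by
      simp only [hiff]
      exact hFl
    refine ⟨(l x₀)⁻¹ • l, hle1, hF1, ?_⟩
    refine Submodule.eq_of_le_of_finrank_eq (Submodule.span_mono fun a ha => ha.1) ?_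
    have hspan := span_face_convexHull (((l x₀)⁻¹ • l : E →L[ℝ] ℝ) : E →ₗ[ℝ] ℝ) hle1
    simp only [ContinuousLinearMap.coe_coe] at hspan
    have hfin := finrank_span_eq_finrank_vectorSpan_add_one ⟨x₀, hx₀⟩
      (((l x₀)⁻¹ • l : E →L[ℝ] ℝ) : E →ₗ[ℝ] ℝ) (fun x hx => by rw [hF1] at hx; exact hx.2)
    rw [← hspan, ← hF1, hfin]
    rw [affineDimension_of_nonempty ⟨x₀, hx₀⟩] at hF
    omega
  · rintro ⟨l, hle, rfl, hspan⟩
    have hspan' := span_face_convexHull (l : E →ₗ[ℝ] ℝ) hle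
    simp only [ContinuousLinearMap.coe_coe] at hspan'
    have hFne : {x | x ∈ convexHull ℝ A ∧ l x = 1}.Nonempty := by
      rw [nonempty_iff_ne_empty]
      intro h
      rw [h, hspan, Submodule.span_empty] at hspan'
      exact hne hspan'.symm
    have hfin := finrank_span_eq_finrank_vectorSpan_add_one hFne (l : E →ₗ[ℝ] ℝ)
      (fun x hx => hx.2)
    rw [hspan', hspan] at hfin
    refine ⟨fun _ => ⟨l, ?_⟩, ?_⟩
    · obtain ⟨x₀, hx₀, hx₀'⟩ := hFne
      ext x
      refine ⟨fun h => ⟨h.1, fun y hy => ?_⟩, fun h => ⟨h.1, le_antisymm ?_ ?_⟩⟩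
      · rw [h.2]
        exact apply_le_of_mem_convexHull (l : E →ₗ[ℝ] ℝ) hle hy
      · exact apply_le_of_mem_convexHull (l : E →ₗ[ℝ] ℝ) hle h.1
      · rw [← hx₀']
        exact h.2 x₀ hx₀
    · rw [affineDimension_of_nonempty hFne, hdim, hfin]
      push_cast
      ring

end SymmetricConvexHull

/-! ### Facets as vertex labellings -/

section SymmetricEdgePolytope

variable {V : Type*} [Fintype V] [DecidableEq V]

/-- The linear functional on `ℝ^V` with the given values on the standard basis. -/
noncomputable def functionalOfValues (u : V → ℝ) : (V → ℝ) →L[ℝ] ℝ :=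
  ∑ i, u i • ContinuousLinearMap.proj i

theorem functionalOfValues_single (u : V → ℝ) (i : V) :
    functionalOfValues u (Pi.single i 1) = u i := by
  simp [functionalOfValues, Pi.single_apply]

theorem functionalOfValues_edge (u : V → ℝ) (i j : V) :
    functionalOfValues u (Pi.single i 1 - Pi.single j 1) = u i - u j := by
  rw [map_sub, functionalOfValues_single, functionalOfValues_single]

theorem functionalOfValues_apply_single (l : (V → ℝ) →ₗ[ℝ] ℝ) :
    (functionalOfValues fun i => l (Pi.single i 1) : (V → ℝ) →ₗ[ℝ] ℝ) = l :=
  LinearMap.pi_ext' fun i => LinearMap.ext_ring (by simp [functionalOfValues_single])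

/-- The face of the symmetric edge polytope where the functional with values `u` equals `1`. -/
def edgePolytopeFace (G : SimpleGraph V) (u : V → ℝ) : Set (V → ℝ) :=
  {x | x ∈ symmetricEdgePolytope G ∧ functionalOfValues u x = 1}

/-- The vertex labellings that cut out facets: neighbours differ by at most one, and a labelling that
is constant along all edges where they differ by exactly one is constant along all edges. -/
structure IsFacetLabelling (G : SimpleGraph V) (u : V → ℝ) : Prop where
  sub_le : ∀ i j, G.Adj i j → u i - u j ≤ 1
  rigid : ∀ w : V → ℝ, (∀ i j, G.Adj i j → u i - u j = 1 → w i = w j) →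
    ∀ i j, G.Adj i j → w i = w j

/-- Rigidity is the dual form of the spanning condition: every functional that kills the tight edge
vectors kills all edge vectors. -/
theorem isFacet_symmetricEdgePolytope_iff {G : SimpleGraph V} (hG : ∃ i j, G.Adj i j)
    (F : Set (V → ℝ)) :
    IsFacet (symmetricEdgePolytope G) F ↔
      ∃ u, IsFacetLabelling G u ∧ F = edgePolytopeFace G u := by
  have hne : Submodule.span ℝ
      {x : V → ℝ | ∃ i j : V, G.Adj i j ∧ x = Pi.single i 1 - Pi.single j 1} ≠ ⊥ := by
    obtain ⟨i, j, hij⟩ := hG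
    intro h
    have := Submodule.span_eq_bot.1 h _ ⟨i, j, hij, rfl⟩
    have := congrFun this i
    simp [hij.ne] at this
  unfold edgePolytopeFace symmetricEdgePolytope
  rw [isFacet_convexHull_iff ?_ hne]
  · constructor
    · rintro ⟨l, hle, rfl, hspan⟩
      obtain ⟨u, rfl⟩ : ∃ u, functionalOfValues u = l :=
        ⟨_, ContinuousLinearMap.coe_injective
          (functionalOfValues_apply_single (l : (V → ℝ) →ₗ[ℝ] ℝ))⟩
      refine ⟨u, ⟨fun i j hij => ?_, fun w hw i j hij => ?_⟩, rfl⟩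
      · rw [← functionalOfValues_edge]
        exact hle _ ⟨i, j, hij, rfl⟩
      · rw [← sub_eq_zero, ← functionalOfValues_edge]
        have hker : Submodule.span ℝ {x : V → ℝ |
            ∃ i j : V, G.Adj i j ∧ x = Pi.single i 1 - Pi.single j 1} ≤
            LinearMap.ker (functionalOfValues w : (V → ℝ) →ₗ[ℝ] ℝ) := by
          rw [← hspan, Submodule.span_le]
          rintro _ ⟨⟨a, b, hab, rfl⟩, h⟩
          rw [functionalOfValues_edge] at h
          change functionalOfValues w _ = 0
          rw [functionalOfValues_edge, hw a b hab h, sub_self]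
        exact hker (Submodule.subset_span ⟨i, j, hij, rfl⟩)
    · rintro ⟨u, hu, rfl⟩
      refine ⟨functionalOfValues u, ?_, rfl, ?_⟩
      · rintro _ ⟨i, j, hij, rfl⟩
        rw [functionalOfValues_edge]
        exact hu.sub_le i j hij
      · refine le_antisymm (Submodule.span_mono fun a ha => ha.1) (Submodule.span_le.2 ?_)
        rintro _ ⟨i, j, hij, rfl⟩
        -- An edge vector outside the tight span is separated from it by a functional, whose
        -- labelling contradicts rigidity.
        by_contra hmem
        obtain ⟨f, hf, hker⟩ := Submodule.exists_le_ker_of_notMem hmem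
        apply hf
        rw [← functionalOfValues_apply_single f, ContinuousLinearMap.coe_coe,
          functionalOfValues_edge, sub_eq_zero]
        refine hu.rigid (fun i => f (Pi.single i 1)) (fun a b hab h => ?_) i j hij
        have : f (Pi.single a 1 - Pi.single b 1) = 0 :=
          hker (Submodule.subset_span ⟨⟨a, b, hab, rfl⟩, by rw [functionalOfValues_edge, h]⟩)
        rwa [map_sub, sub_eq_zero] at this
  · rintro _ ⟨i, j, hij, rfl⟩
    exact ⟨j, i, hij.symm, by rw [neg_sub]⟩

/-- Adding a constant to a labelling does not change its face. -/
theorem edgePolytopeFace_congr {G : SimpleGraph V} {u v : V → ℝ}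
    (h : ∀ i j, G.Adj i j → u i - u j = v i - v j) :
    edgePolytopeFace G u = edgePolytopeFace G v := by
  have heq : ∀ x ∈ symmetricEdgePolytope G, functionalOfValues u x = functionalOfValues v x := by
    intro x hx
    have hx' : x ∈ (LinearMap.eqLocus (functionalOfValues u : (V → ℝ) →ₗ[ℝ] ℝ)
        (functionalOfValues v : (V → ℝ) →ₗ[ℝ] ℝ) : Set (V → ℝ)) := by
      refine convexHull_min ?_ (Submodule.convex _) hx
      rintro _ ⟨i, j, hij, rfl⟩
      change functionalOfValues u _ = functionalOfValues v _
      rw [functionalOfValues_edge, functionalOfValues_edge, h i j hij]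
    exact hx'
  ext x
  exact and_congr_right fun hx => by rw [heq x hx]

/-- A facet determines its labelling up to constants on connected components. -/
theorem IsFacetLabelling.sub_eq_of_face_eq {G : SimpleGraph V} {u v : V → ℝ}
    (hu : IsFacetLabelling G u) (h : edgePolytopeFace G u = edgePolytopeFace G v) (i j : V)
    (hij : G.Adj i j) : u i - u j = v i - v j := by
  -- An edge tight for `u` gives a point of the common face, so it is tight for `v` too and `u - v`
  -- is constant along it.
  have := hu.rigid (u - v) (fun a b hab h1 => ?_) i j hij
  · simp only [Pi.sub_apply] at this
    linarith
  · have hmem : (Pi.single a 1 - Pi.single b 1 : V → ℝ) ∈ edgePolytopeFace G u :=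
      ⟨subset_convexHull ℝ _ ⟨a, b, hab, rfl⟩, by rw [functionalOfValues_edge, h1]⟩
    rw [h] at hmem
    have h2 := hmem.2
    rw [functionalOfValues_edge] at h2
    simp only [Pi.sub_apply]
    linarith

end SymmetricEdgePolytope

/-! ### Labellings of the windmill, triangle by triangle -/

section Windmill

variable {m : ℕ}

/-- The first outer vertex of a triangle of the full windmill. -/
def outerOdd (t : Fin m) : Fin (2 * m + 1) := ⟨2 * t.val + 1, by omega⟩

/-- The second outer vertex of a triangle of the full windmill. -/
def outerEven (t : Fin m) : Fin (2 * m + 1) := ⟨2 * t.val + 2, by omega⟩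

theorem eq_zero_or_outer (i : Fin (2 * m + 1)) :
    i = 0 ∨ ∃ t : Fin m, i = outerOdd t ∨ i = outerEven t := by
  rcases Nat.eq_zero_or_pos i.val with h | h
  · exact Or.inl (Fin.ext h)
  · refine Or.inr ⟨⟨(i.val - 1) / 2, by omega⟩, ?_⟩
    simp only [outerOdd, outerEven, Fin.ext_iff]
    omega

theorem fullWindmill_adj_iff {i j : Fin (2 * m + 1)} : (fullWindmill (2 * m + 1)).Adj i j ↔
    ∃ t : Fin m, (i = 0 ∧ j = outerOdd t) ∨ (i = outerOdd t ∧ j = 0) ∨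
      (i = 0 ∧ j = outerEven t) ∨ (i = outerEven t ∧ j = 0) ∨
      (i = outerOdd t ∧ j = outerEven t) ∨ (i = outerEven t ∧ j = outerOdd t) := by
  simp only [fullWindmill, windmill, outerOdd, outerEven, Fin.ext_iff, Ne, Fin.val_zero]
  constructor
  · rintro ⟨hne, h⟩
    rcases Nat.eq_zero_or_pos i.val with hi | hi
    · exact ⟨⟨(j.val - 1) / 2, by omega⟩, by simp only; omega⟩
    · exact ⟨⟨(i.val - 1) / 2, by omega⟩, by simp only; omega⟩
  · rintro ⟨t, h⟩
    omega

/-- The labels of the outer vertices of a triangle relative to the common vertex, in the six ways in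
which two of its three edges are tight. -/
def triangleLabels : Fin 6 → ℝ × ℝ :=
  ![(1, 1), (-1, -1), (1, 0), (0, 1), (-1, 0), (0, -1)]

theorem triangleLabels_injective : Function.Injective triangleLabels := by
  intro i j h
  fin_cases i <;> fin_cases j <;> first | rfl | (exfalso; norm_num [triangleLabels] at h)

/-- Each of `h1`, `h2`, `h3` says that one pair of the triangle's edges contains a tight one;
together they make at least two edges tight. -/
theorem exists_triangleLabels_eq {x y : ℝ} (hx : x ≤ 1) (hx' : -x ≤ 1) (hy : y ≤ 1)
    (hy' : -y ≤ 1) (hxy : x - y ≤ 1) (hyx : y - x ≤ 1)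
    (h1 : (x = 1 ∨ x = -1) ∨ (x - y = 1 ∨ y - x = 1))
    (h2 : (y = 1 ∨ y = -1) ∨ (x - y = 1 ∨ y - x = 1))
    (h3 : (x = 1 ∨ x = -1) ∨ (y = 1 ∨ y = -1)) :
    ∃ k, triangleLabels k = (x, y) := by
  have h : (x = 1 ∧ y = 1) ∨ (x = -1 ∧ y = -1) ∨ (x = 1 ∧ y = 0) ∨ (x = 0 ∧ y = 1) ∨
      (x = -1 ∧ y = 0) ∨ (x = 0 ∧ y = -1) := by
    grind
  rcases h with ⟨rfl, rfl⟩ | ⟨rfl, rfl⟩ | ⟨rfl, rfl⟩ | ⟨rfl, rfl⟩ | ⟨rfl, rfl⟩ | ⟨rfl, rfl⟩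
  · exact ⟨0, rfl⟩
  · exact ⟨1, rfl⟩
  · exact ⟨2, rfl⟩
  · exact ⟨3, rfl⟩
  · exact ⟨4, rfl⟩
  · exact ⟨5, rfl⟩

/-- The labelling of the full windmill with a choice of labels for each triangle. -/
noncomputable def windmillLabelling (c : Fin m → Fin 6) (i : Fin (2 * m + 1)) : ℝ :=
  if h : i.val = 0 then 0
  else if i.val % 2 = 1 then (triangleLabels (c ⟨(i.val - 1) / 2, by omega⟩)).1
  else (triangleLabels (c ⟨(i.val - 1) / 2, by omega⟩)).2

theorem windmillLabelling_zero (c : Fin m → Fin 6) : windmillLabelling c 0 = 0 := by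
  simp [windmillLabelling]

theorem windmillLabelling_outerOdd (c : Fin m → Fin 6) (t : Fin m) :
    windmillLabelling c (outerOdd t) = (triangleLabels (c t)).1 := by
  have h : (⟨(2 * t.val + 1 - 1) / 2, by omega⟩ : Fin m) = t := Fin.ext (by simp only; omega)
  unfold windmillLabelling outerOdd
  rw [dif_neg (by simp only; omega), if_pos (by simp only; omega)]
  simp only [h]

theorem windmillLabelling_outerEven (c : Fin m → Fin 6) (t : Fin m) :
    windmillLabelling c (outerEven t) = (triangleLabels (c t)).2 := by
  have h : (⟨(2 * t.val + 2 - 1) / 2, by omega⟩ : Fin m) = t := Fin.ext (by simp only; omega)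
  unfold windmillLabelling outerEven
  rw [dif_neg (by simp only; omega), if_neg (by simp only; omega)]
  simp only [h]

theorem adj_zero_outerOdd (t : Fin m) : (fullWindmill (2 * m + 1)).Adj 0 (outerOdd t) :=
  fullWindmill_adj_iff.2 ⟨t, by simp⟩

theorem adj_zero_outerEven (t : Fin m) : (fullWindmill (2 * m + 1)).Adj 0 (outerEven t) :=
  fullWindmill_adj_iff.2 ⟨t, by simp⟩

theorem adj_outerOdd_outerEven (t : Fin m) :
    (fullWindmill (2 * m + 1)).Adj (outerOdd t) (outerEven t) :=
  fullWindmill_adj_iff.2 ⟨t, by simp⟩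

theorem isFacetLabelling_windmillLabelling (c : Fin m → Fin 6) :
    IsFacetLabelling (fullWindmill (2 * m + 1)) (windmillLabelling c) := by
  refine ⟨fun i j hij => ?_, fun w hw => ?_⟩
  · obtain ⟨t, h⟩ := fullWindmill_adj_iff.1 hij
    rcases h with ⟨rfl, rfl⟩ | ⟨rfl, rfl⟩ | ⟨rfl, rfl⟩ | ⟨rfl, rfl⟩ | ⟨rfl, rfl⟩ | ⟨rfl, rfl⟩ <;>
      simp only [windmillLabelling_zero, windmillLabelling_outerOdd,
        windmillLabelling_outerEven] <;>
      generalize c t = k <;> fin_cases k <;> norm_num [triangleLabels]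
  · have key : ∀ t : Fin m, w 0 = w (outerOdd t) ∧ w 0 = w (outerEven t) := by
      intro t
      have e1 := hw _ _ (adj_zero_outerOdd t)
      have e2 := hw _ _ (adj_zero_outerOdd t).symm
      have e3 := hw _ _ (adj_zero_outerEven t)
      have e4 := hw _ _ (adj_zero_outerEven t).symm
      have e5 := hw _ _ (adj_outerOdd_outerEven t)
      have e6 := hw _ _ (adj_outerOdd_outerEven t).symm
      simp only [windmillLabelling_zero, windmillLabelling_outerOdd,
        windmillLabelling_outerEven] at e1 e2 e3 e4 e5 e6
      generalize c t = k at e1 e2 e3 e4 e5 e6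
      fin_cases k <;> norm_num [triangleLabels] at e1 e2 e3 e4 e5 e6 <;> grind
    intro i j hij
    obtain ⟨t, h⟩ := fullWindmill_adj_iff.1 hij
    have := key t
    rcases h with ⟨rfl, rfl⟩ | ⟨rfl, rfl⟩ | ⟨rfl, rfl⟩ | ⟨rfl, rfl⟩ | ⟨rfl, rfl⟩ | ⟨rfl, rfl⟩ <;>
      grind

theorem outerOdd_ne_zero (t : Fin m) : outerOdd t ≠ 0 := by
  simp [outerOdd, Fin.ext_iff]

theorem outerEven_ne_zero (t : Fin m) : outerEven t ≠ 0 := by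
  simp [outerEven, Fin.ext_iff]

theorem outerOdd_ne_outerEven (s t : Fin m) : outerOdd s ≠ outerEven t := by
  simp only [outerOdd, outerEven, Ne, Fin.ext_iff]
  omega

theorem outerOdd_injective : Function.Injective (outerOdd : Fin m → Fin (2 * m + 1)) := by
  intro s t h
  simp only [outerOdd, Fin.ext_iff] at h
  exact Fin.ext (by omega)

theorem outerEven_injective : Function.Injective (outerEven : Fin m → Fin (2 * m + 1)) := by
  intro s t h
  simp only [outerEven, Fin.ext_iff] at h
  exact Fin.ext (by omega)

/-- In a facet labelling of the full windmill, each triangle has two tight edges. -/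
theorem IsFacetLabelling.exists_triangleLabels {u : Fin (2 * m + 1) → ℝ}
    (hu : IsFacetLabelling (fullWindmill (2 * m + 1)) u) (t : Fin m) :
    ∃ k, triangleLabels k = (u (outerOdd t) - u 0, u (outerEven t) - u 0) := by
  have d1 := hu.sub_le _ _ (adj_zero_outerOdd t)
  have d2 := hu.sub_le _ _ (adj_zero_outerOdd t).symm
  have d3 := hu.sub_le _ _ (adj_zero_outerEven t)
  have d4 := hu.sub_le _ _ (adj_zero_outerEven t).symm
  have d5 := hu.sub_le _ _ (adj_outerOdd_outerEven t)
  have d6 := hu.sub_le _ _ (adj_outerOdd_outerEven t).symm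
  have n1 := outerOdd_ne_zero t
  have n2 := outerEven_ne_zero t
  have n3 := outerOdd_ne_outerEven t t
  have hrigid : ∀ w : Fin (2 * m + 1) → ℝ,
      (∀ s : Fin m, s ≠ t → w (outerOdd s) = w 0 ∧ w (outerEven s) = w 0) →
      ((u (outerOdd t) - u 0 = 1 ∨ u (outerOdd t) - u 0 = -1) → w (outerOdd t) = w 0) →
      ((u (outerEven t) - u 0 = 1 ∨ u (outerEven t) - u 0 = -1) → w (outerEven t) = w 0) →
      ((u (outerOdd t) - u (outerEven t) = 1 ∨ u (outerEven t) - u (outerOdd t) = 1) →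
        w (outerOdd t) = w (outerEven t)) →
      w (outerOdd t) = w 0 ∧ w (outerEven t) = w 0 := by
    intro w hs h1 h2 h3
    have hw := hu.rigid w (fun i j hij h => ?_)
    · exact ⟨hw _ _ (adj_zero_outerOdd t).symm, hw _ _ (adj_zero_outerEven t).symm⟩
    · obtain ⟨s, hs'⟩ := fullWindmill_adj_iff.1 hij
      by_cases hst : s = t
      · subst hst
        rcases hs' with ⟨rfl, rfl⟩ | ⟨rfl, rfl⟩ | ⟨rfl, rfl⟩ | ⟨rfl, rfl⟩ | ⟨rfl, rfl⟩ | ⟨rfl, rfl⟩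
        · exact (h1 (Or.inr (by linarith))).symm
        · exact h1 (Or.inl h)
        · exact (h2 (Or.inr (by linarith))).symm
        · exact h2 (Or.inl h)
        · exact h3 (Or.inl h)
        · exact (h3 (Or.inr h)).symm
      · obtain ⟨k1, k2⟩ := hs s hst
        rcases hs' with ⟨rfl, rfl⟩ | ⟨rfl, rfl⟩ | ⟨rfl, rfl⟩ | ⟨rfl, rfl⟩ | ⟨rfl, rfl⟩ | ⟨rfl, rfl⟩
        all_goals simp only [k1, k2]
  have o1 : ∀ s, s ≠ t → outerOdd s ≠ outerOdd t := fun s hs h => hs (outerOdd_injective h)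
  have o2 : ∀ s, s ≠ t → outerEven s ≠ outerEven t := fun s hs h => hs (outerEven_injective h)
  refine exists_triangleLabels_eq (by linarith) (by linarith) (by linarith) (by linarith)
    (by linarith) (by linarith) ?_ ?_ ?_
  -- If no tight edge crosses a cut of the triangle, the indicator of the side away from the hub
  -- contradicts rigidity. The three cuts isolate the odd vertex, the even vertex and the hub.
  · by_contra hcon
    rw [sub_sub_sub_cancel_right, sub_sub_sub_cancel_right, not_or] at hcon
    have := (hrigid (Pi.single (outerOdd t) 1)
      (fun s hs => by simp [o1 s hs, n1.symm, (outerOdd_ne_outerEven t s).symm])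
      (fun h => absurd h hcon.1) (fun _ => by simp [n1.symm, n3.symm])
      (fun h => absurd h hcon.2)).1
    simp [n1.symm] at this
  · by_contra hcon
    rw [sub_sub_sub_cancel_right, sub_sub_sub_cancel_right, not_or] at hcon
    have := (hrigid (Pi.single (outerEven t) 1)
      (fun s hs => by simp [o2 s hs, n2.symm, outerOdd_ne_outerEven s t])
      (fun _ => by simp [n2.symm, n3]) (fun h => absurd h hcon.1)
      (fun h => absurd h hcon.2)).2
    simp [n2.symm] at this
  · by_contra hcon
    rw [not_or] at hcon
    have := (hrigid (Pi.single (outerOdd t) 1 + Pi.single (outerEven t) 1)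
      (fun s hs => by
        simp [o1 s hs, o2 s hs, n1.symm, n2.symm, outerOdd_ne_outerEven s t,
          (outerOdd_ne_outerEven t s).symm])
      (fun h => absurd h hcon.1) (fun h => absurd h hcon.2)
      (fun _ => by simp [n3, n3.symm])).1
    simp [n1.symm, n2.symm, n3] at this

theorem isFacet_fullWindmill_iff (hm : 0 < m) (F : Set (Fin (2 * m + 1) → ℝ)) :
    IsFacet (symmetricEdgePolytope (fullWindmill (2 * m + 1))) F ↔
      ∃ c : Fin m → Fin 6,
        edgePolytopeFace (fullWindmill (2 * m + 1)) (windmillLabelling c) = F := by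
  rw [isFacet_symmetricEdgePolytope_iff ⟨_, _, adj_zero_outerOdd ⟨0, hm⟩⟩]
  constructor
  · rintro ⟨u, hu, rfl⟩
    choose c hc using hu.exists_triangleLabels
    refine ⟨c, edgePolytopeFace_congr ?_⟩
    have key : ∀ i, windmillLabelling c i = u i - u 0 := by
      intro i
      rcases eq_zero_or_outer i with rfl | ⟨t, rfl | rfl⟩
      · rw [windmillLabelling_zero, sub_self]
      · rw [windmillLabelling_outerOdd, hc]
      · rw [windmillLabelling_outerEven, hc]
    intro i j _
    rw [key, key, sub_sub_sub_cancel_right]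
  · rintro ⟨c, rfl⟩
    exact ⟨_, isFacetLabelling_windmillLabelling c, rfl⟩

/-- The face fixes label differences along edges, and the hub has label 0, so the labels of each
triangle can be read off. -/
theorem windmillFace_injective : Function.Injective fun c : Fin m → Fin 6 =>
    edgePolytopeFace (fullWindmill (2 * m + 1)) (windmillLabelling c) := by
  intro c d h
  have hsub := (isFacetLabelling_windmillLabelling c).sub_eq_of_face_eq h
  funext t
  have h1 := hsub _ _ (adj_zero_outerOdd t)
  have h2 := hsub _ _ (adj_zero_outerEven t)
  simp only [windmillLabelling_zero, windmillLabelling_outerOdd,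
    windmillLabelling_outerEven, zero_sub, neg_inj] at h1 h2
  exact triangleLabels_injective (Prod.ext h1 h2)

theorem numFacets_fullWindmill (hm : 0 < m) :
    numFacets (symmetricEdgePolytope (fullWindmill (2 * m + 1))) = 6 ^ m := by
  have : {F | IsFacet (symmetricEdgePolytope (fullWindmill (2 * m + 1))) F} =
      range fun c : Fin m → Fin 6 =>
        edgePolytopeFace (fullWindmill (2 * m + 1)) (windmillLabelling c) :=
    Set.ext fun F => isFacet_fullWindmill_iff hm F
  rw [numFacets, this, ← image_univ, ncard_image_of_injective _ windmillFace_injective,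
    ncard_univ]
  simp

end Windmill

theorem mainTheorem10 (n : ℕ) (hodd : Odd n) (hn : 3 ≤ n) :
    numFacets (symmetricEdgePolytope (fullWindmill n)) = 6 ^ ((n - 1) / 2) := by
  obtain ⟨m, rfl⟩ := hodd
  -- `3 ≤ n` provides a triangle; with none, the polytope is empty and has no facets.
  rw [numFacets_fullWindmill (by omega)]
  congr 1
  omega
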